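/- Let $n\ge 0$, let $(\overline M,\overline g)$ be a smooth pseudo-Riemannian manifold of dimension $n+2$ with Levi-Civita connection $\overline\nabla$, and let $M$ be an immersed totally geodesic lightlike hypersurface with induced metric $g_0$: $g_0$ is degenerate at every point, with radical $\mathrm{Rad}\,TM=\{X : g_0(X,\cdot)=0\}=TM^\perp$, and $\overline\nabla_XY$ is tangent to $M$ whenever $X,Y$ are. Let $c$ be the set of all metrics $e^{-2f}g_0$ on $M$ with $f\in C^\infty(M)$ and $X(f)=0$ for $X\in\mathrm{Rad}\,TM$. Let $S(TM)$ be an integrable screen distribution, i.e. a smooth integrable distribution of rank $n$ with $TM=S(TM)\oplus\mathrm{Rad}\,TM$. Let $D$ be a Weyl screen structure on $(M,c,S(TM))$: a torsion-free linear connection on $M$ such that for each $g\in c$ there is a unique $1$-form $\theta_g$ with $Dg=-2\theta_g\otimes g$, and such that $D_XY\in\Gamma(S(TM))$ for all $X\in\Gamma(TM)$ and $Y\in\Gamma(S(TM))$. A $1$-form is called horizontal if it vanishes on $\mathrm{Rad}\,TM$. Then: (i) For every $g\in c$ the $1$-form $\theta_g$ is horizontal. (ii) Let $g\in c$, let $\xi$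 be a nowhere vanishing smooth section of $\mathrm{Rad}\,TM$, and let $D^g$ be a smooth torsion-free linear connection on $M$ with $D^gg=0$. Let $\eta=\overline g(N,\cdot)$ on $TM$, where $N$ is the unique vector field along $M$ with $\overline g(N,\xi)=1$ and $\overline g(N,N)=\overline g(N,W)=0$ for all $W\in S(TM)$ (so $\eta(\xi)=1$ and $\eta$ vanishes on $S(TM)$). For a $1$-form $\theta$ let $\theta^{\sharp_g}$ be the vector field with $g(\theta^{\sharp_g},\cdot)+\eta(\theta^{\sharp_g})\,\eta=\theta$. Then there is exactly one pair $(\theta,S)$ consisting of a smooth horizontal $1$-form $\theta$ and a smooth symmetric bilinear form $S$ on $TM$ such that $$D_XY=D^g_XY+\theta(X)Y+\theta(Y)X-g(X,Y)\,\theta^{\sharp_g}-S(X,Y)\,\xi\qquad\text{for all }X,Y\in\Gamma(TM),$$ and in this pair $\theta=\theta_g$. Moreover $$S(X,Y)=C(X,Y)+\eta(X)\,\theta_g(Y)\qquad\text{for } X\in\Gamma(TM),\ Y\in\Gamma(S(TM)),$$ where $C(X,Y)=\eta(D^g_XY)$ is the second fundamental form of $S(TM)$ with respect to $D^g$; and if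 $\xi$ and $D^g$ are normalized by $D_\xi\xi=0$ and $D^g_\xi\xi=0$, then $S(X,Y)=0$ for $X,Y\in\mathrm{Rad}\,TM$. -/

import Mathlib

open Bundle Manifold VectorField Topology
open scoped ContDiff

noncomputable section

namespace WeylScreen

section Fields

variable {E : Type*} [NormedAddCommGroup E] [NormedSpace ℝ E]
  {H : Type*} [TopologicalSpace H] (I : ModelWithCorners ℝ E H)
  (M : Type*) [TopologicalSpace M] [ChartedSpace H M]

/-- Fields of bilinear forms on `M`, with no regularity imposed. -/
abbrev BilinField : Type _ :=
  (x : M) → TangentSpace I x →L[ℝ] TangentSpace I x →L[ℝ] ℝ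

/-- Fields of linear forms on `M`, with no regularity imposed. -/
abbrev OneForm : Type _ := (x : M) → TangentSpace I x →L[ℝ] ℝ

/-- Vector fields on `M`, with no regularity imposed. -/
abbrev VField : Type _ := (x : M) → TangentSpace I x

/-- Fields of tangent subspaces on `M`, with no regularity imposed. -/
abbrev Distribution : Type _ := (x : M) → Submodule ℝ (TangentSpace I x)

/-- Linear connections on the tangent bundle of `M`;
`D Y x v` is the derivative of `Y` at `x` in the direction `v`. -/
abbrev Connection [IsManifold I 1 M] : Type _ :=
  CovariantDerivative I E (TangentSpace I : M → Type _)

variable {I M}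

/-- The field of bilinear forms is of class `C^∞`. -/
def BilinField.IsSmooth [IsManifold I 1 M] (g : BilinField I M) : Prop :=
  ContMDiff I (I.prod 𝓘(ℝ, E →L[ℝ] E →L[ℝ] ℝ)) ∞
    (fun x ↦ TotalSpace.mk' (E →L[ℝ] E →L[ℝ] ℝ)
      (E := fun x : M ↦ TangentSpace I x →L[ℝ] TangentSpace I x →L[ℝ] ℝ) x (g x))

/-- The field of linear forms is of class `C^∞`. -/
def OneForm.IsSmooth [IsManifold I 1 M] (θ : OneForm I M) : Prop :=
  ContMDiff I (I.prod 𝓘(ℝ, E →L[ℝ] ℝ)) ∞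
    (fun x ↦ TotalSpace.mk' (E →L[ℝ] ℝ) (E := fun x : M ↦ TangentSpace I x →L[ℝ] ℝ) x (θ x))

/-- The vector field is differentiable at `x`. -/
def VField.DiffAt [IsManifold I 1 M] (X : VField I M) (x : M) : Prop :=
  MDifferentiableAt I (I.prod 𝓘(ℝ, E)) (fun y ↦ (⟨y, X y⟩ : TangentBundle I M)) x

/-- The vector field is of class `C^∞` on the set `U`. -/
def VField.SmoothOn [IsManifold I 1 M] (X : VField I M) (U : Set M) : Prop :=
  ContMDiffOn I (I.prod 𝓘(ℝ, E)) ∞ (fun y ↦ (⟨y, X y⟩ : TangentBundle I M)) U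

/-- `g x u v = g x v u` for all `u`, `v`. -/
def BilinField.IsSymm (g : BilinField I M) : Prop :=
  ∀ (x : M) (u v : TangentSpace I x), g x u v = g x v u

/-- A smooth symmetric nondegenerate field of bilinear forms, of any signature. -/
structure IsPseudoRiemannianMetric [IsManifold I 1 M] (g : BilinField I M) : Prop where
  smooth : g.IsSmooth
  symm : g.IsSymm
  nondegenerate : ∀ (x : M) (v : TangentSpace I x), (∀ w, g x v w = 0) → v = 0

/-- The kernel of a field of bilinear forms at `x`. -/
def radical (g : BilinField I M) : Distribution I M := fun x ↦
  { carrier := {v | ∀ w, g x v w = 0}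
    zero_mem' := fun w ↦ by simp
    add_mem' := fun {a b} ha hb w ↦ by simp [ha w, hb w]
    smul_mem' := fun c a ha w ↦ by simp [ha w] }

/-- A linear form is horizontal if it vanishes on the radical distribution. -/
def OneForm.IsHorizontal (g : BilinField I M) (θ : OneForm I M) : Prop :=
  ∀ x, ∀ v ∈ radical g x, θ x v = 0

/-- `(D_v g)(Y, Z) = v(g(Y, Z)) - g(D_v Y, Z) - g(Y, D_v Z)` at the point `x`. -/
def covDerivMetric [IsManifold I 1 M] (D : Connection I M) (g : BilinField I M)
    (Y Z : VField I M) (x : M) (v : TangentSpace I x) : ℝ :=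
  mvfderiv I (fun y ↦ g y (Y y) (Z y)) x v - g x (D Y x v) (Z x) - g x (Y x) (D Z x v)

/-- `D g = -2 θ ⊗ g`. -/
def IsRecurrent [IsManifold I 1 M] (D : Connection I M) (g : BilinField I M)
    (θ : OneForm I M) : Prop :=
  ∀ (x : M) (Y Z : VField I M), Y.DiffAt x → Z.DiffAt x → ∀ v : TangentSpace I x,
    covDerivMetric D g Y Z x v = -2 * θ x v * g x (Y x) (Z x)

/-- `D g = 0`. -/
def IsCompatible [IsManifold I 1 M] (D : Connection I M) (g : BilinField I M) : Prop :=
  ∀ (x : M) (Y Z : VField I M), Y.DiffAt x → Z.DiffAt x → ∀ v : TangentSpace I x,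
    covDerivMetric D g Y Z x v = 0

/-- A smooth torsion-free linear connection. -/
structure IsSymmetricConnection [FiniteDimensional ℝ E] [CompleteSpace E] [IsManifold I ∞ M]
    (D : Connection I M) : Prop where
  smooth : ContMDiffCovariantDerivativeOn E ∞ D.toFun Set.univ
  torsion_eq_zero : D.torsion = 0

/-- The Levi-Civita connection of a pseudo-Riemannian metric: symmetric and metric. -/
structure IsLeviCivita [FiniteDimensional ℝ E] [CompleteSpace E] [IsManifold I ∞ M]
    (D : Connection I M) (g : BilinField I M) : Prop where
  symmetric : IsSymmetricConnection D
  compatible : IsCompatible D g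

/-- A smooth distribution of rank `k`: it is locally spanned by `k` smooth vector fields
that are linearly independent at each point. -/
def Distribution.IsSmoothOfRank [IsManifold I 1 M] (Δ : Distribution I M) (k : ℕ) : Prop :=
  ∀ x : M, ∃ U : Set M, IsOpen U ∧ x ∈ U ∧ ∃ s : Fin k → VField I M,
    (∀ i, (s i).SmoothOn U) ∧
    ∀ y ∈ U, LinearIndependent ℝ (fun i ↦ s i y) ∧
      Submodule.span ℝ (Set.range fun i ↦ s i y) = Δ y

/-- Integrability in the sense of Frobenius: brackets of sections are sections. -/
def Distribution.IsIntegrable [IsManifold I 1 M] (Δ : Distribution I M) : Prop :=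
  ∀ (x : M) (X Y : VField I M), X.DiffAt x → Y.DiffAt x →
    (∀ᶠ y in 𝓝 x, X y ∈ Δ y) → (∀ᶠ y in 𝓝 x, Y y ∈ Δ y) → mlieBracket I X Y x ∈ Δ x

/-- `D_X Y` is a section of `Δ` for every section `Y` of `Δ` and every `X`. -/
def Distribution.IsParallel [IsManifold I 1 M] (Δ : Distribution I M) (D : Connection I M) :
    Prop :=
  ∀ (x : M) (Y : VField I M), Y.DiffAt x → (∀ᶠ y in 𝓝 x, Y y ∈ Δ y) →
    ∀ v : TangentSpace I x, D Y x v ∈ Δ x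

/-- The metrics `e^{-2f} g₀` with `f` smooth and annihilated by the radical of `g₀`. -/
def conformalClass (g₀ : BilinField I M) : Set (BilinField I M) :=
  {g | ∃ f : M → ℝ, ContMDiff I 𝓘(ℝ, ℝ) ∞ f ∧
    (∀ x, ∀ v ∈ radical g₀ x, mvfderiv I f x v = 0) ∧
    ∀ x, g x = Real.exp (-2 * f x) • g₀ x}

/-- A Weyl structure relative to a class `c` of metrics: a torsion-free connection `D` such that
each `g ∈ c` has a unique `1`-form `θ` with `D g = -2 θ ⊗ g`. -/
structure IsWeylStructure [FiniteDimensional ℝ E] [CompleteSpace E] [IsManifold I ∞ M]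
    (c : Set (BilinField I M)) (D : Connection I M) : Prop where
  symmetric : IsSymmetricConnection D
  existsUnique : ∀ g ∈ c, ∃! θ : OneForm I M, θ.IsSmooth ∧ IsRecurrent D g θ

/-- A Weyl structure for which the screen distribution `Sc` is parallel. -/
structure IsWeylScreenStructure [FiniteDimensional ℝ E] [CompleteSpace E] [IsManifold I ∞ M]
    (c : Set (BilinField I M)) (Sc : Distribution I M) (D : Connection I M) : Prop where
  weyl : IsWeylStructure c D
  parallel : Sc.IsParallel D

/-- The map `v ↦ v^♭ = g(v, ·) + η(v) η`. -/
def flat (g : BilinField I M) (η : OneForm I M) (x : M) (v : TangentSpace I x) :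
    TangentSpace I x →L[ℝ] ℝ :=
  g x v + η x v • η x

/-- The dual vector field `θ^♯` of a `1`-form: `♯` is the inverse of `♭`. -/
def sharp (g : BilinField I M) (η : OneForm I M) (θ : OneForm I M) : VField I M :=
  fun x ↦ Function.invFun (flat g η x) (θ x)

end Fields

section Hypersurface

variable {E : Type*} [NormedAddCommGroup E] [NormedSpace ℝ E]
  {H : Type*} [TopologicalSpace H] {I : ModelWithCorners ℝ E H}
  {M : Type*} [TopologicalSpace M] [ChartedSpace H M]
  {E' : Type*} [NormedAddCommGroup E'] [NormedSpace ℝ E']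
  {H' : Type*} [TopologicalSpace H'] {I' : ModelWithCorners ℝ E' H'}
  {N : Type*} [TopologicalSpace N] [ChartedSpace H' N]

/-- The metric `ι^* h` induced on `M` by a map `ι : M → N` and a metric `h` on `N`. -/
def inducedMetric (ι : M → N) (h : BilinField I' N) : BilinField I M := fun x ↦
  ContinuousLinearMap.bilinearComp (E := E') (F := E') (E' := E) (F' := E) (h (ι x))
    (mfderiv I I' ι x) (mfderiv I I' ι x)

theorem inducedMetric_apply (ι : M → N) (h : BilinField I' N) (x : M) (v w : TangentSpace I x) :
    inducedMetric (I := I) ι h x v w = h (ι x) (mfderiv I I' ι x v) (mfderiv I I' ι x w) := rfl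

/-- The radical of `g` is nonzero at each point. For the metric induced on a hypersurface of a
pseudo-Riemannian manifold this says that `T M^⊥ ⊆ T M`, and the radical is then `T M^⊥`. -/
def IsLightlike (g : BilinField I M) : Prop := ∀ x, radical g x ≠ ⊥

/-- The immersed manifold `ι : M → N` is totally geodesic for the connection `Dbar` of `N`:
the derivatives, in directions tangent to `M`, of fields tangent to `M` are tangent to `M`,
that is, the second fundamental form of `M` vanishes. -/
def IsTotallyGeodesic [IsManifold I' 1 N] (I : ModelWithCorners ℝ E H)
    (ι : M → N) (Dbar : Connection I' N) : Prop :=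
  ∀ (x : M) (Y : VField I' N), Y.DiffAt (ι x) →
    (∀ᶠ y in 𝓝 x, Y (ι y) ∈ Set.range (mfderiv I I' ι y)) →
    ∀ v : TangentSpace I x, Dbar Y (ι x) (mfderiv I I' ι x v) ∈ Set.range (mfderiv I I' ι x)

/-- A screen distribution: a smooth rank `n` complement of the radical distribution. -/
structure IsScreenDistribution [IsManifold I 1 M] (n : ℕ) (g : BilinField I M) (Sc : Distribution I M) : Prop where
  smooth : Sc.IsSmoothOfRank n
  isCompl : ∀ x, IsCompl (Sc x) (radical g x)

/-- The lightlike transversal field normalized by `ξ`: the unique field `T` along `ι` with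
`h(T, ξ) = 1` and `h(T, T) = h(T, W) = 0` for `W` in the screen distribution `Sc`. -/
def transversal (ι : M → N) (h : BilinField I' N) (Sc : Distribution I M) (ξ : VField I M)
    (x : M) : TangentSpace I' (ι x) :=
  Classical.epsilon fun T ↦ h (ι x) T (mfderiv I I' ι x (ξ x)) = 1 ∧ h (ι x) T T = 0 ∧
    ∀ w ∈ Sc x, h (ι x) T (mfderiv I I' ι x w) = 0

/-- The `1`-form `η = h(T, ·)` on `M`, `T` being the lightlike transversal field. It depends only
on `ξ` and on the screen distribution: `η(ξ) = 1` and `η` vanishes on the screen distribution. -/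
def eta (ι : M → N) (h : BilinField I' N) (Sc : Distribution I M) (ξ : VField I M) :
    OneForm I M := fun x ↦
  (h (ι x) (transversal ι h Sc ξ x)).comp (mfderiv I I' ι x)

end Hypersurface

/-- The second fundamental form `C(v, Y)` of the screen distribution for the connection `Dg`: the
coefficient of `ξ` in the radical component of `Dg_v Y`, for `Y` in the screen distribution. -/
def screenForm {E : Type*} [NormedAddCommGroup E] [NormedSpace ℝ E]
    {H : Type*} [TopologicalSpace H] {I : ModelWithCorners ℝ E H}
    {M : Type*} [TopologicalSpace M] [ChartedSpace H M] [IsManifold I 1 M]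
    (Dg : Connection I M) (η : OneForm I M) (Y : VField I M) (x : M)
    (v : TangentSpace I x) : ℝ :=
  η x (Dg Y x v)

/-- `D_X Y = Dg_X Y + θ(X) Y + θ(Y) X - g(X, Y) θ^♯ - S(X, Y) ξ`. -/
def IsWeylDecomposition {E : Type*} [NormedAddCommGroup E] [NormedSpace ℝ E]
    {H : Type*} [TopologicalSpace H] {I : ModelWithCorners ℝ E H}
    {M : Type*} [TopologicalSpace M] [ChartedSpace H M] [IsManifold I 1 M]
    (D Dg : Connection I M) (g : BilinField I M) (η : OneForm I M) (ξ : VField I M)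
    (θ : OneForm I M) (S : BilinField I M) : Prop :=
  ∀ (x : M) (Y : VField I M), Y.DiffAt x → ∀ v : TangentSpace I x,
    D Y x v = Dg Y x v + θ x v • Y x + θ x (Y x) • v - g x v (Y x) • sharp g η θ x
      - S x v (Y x) • ξ x

end WeylScreen

end

/-! Part (i). If `g = e^{-2f} g₀` and `D g = -2 θ ⊗ g`, then `D g₀ = -2 (θ - df) ⊗ g₀`, and `df`
vanishes on the radical, so `g₀` can be studied instead. Extend tangent vectors at a point to
commuting fields related to commuting ambient fields. For tangent vectors put `A(c,a,b) = h(Dbar_c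
a, b)` and `B(c,a,b) = g₀(D_c a, b)`. Both are symmetric in `c, a`, and both vanish for `b = v`
radical, `A` because the hypersurface is totally geodesic. The derivative of `g₀(a,b)` gives
`A(c,a,b) + A(c,b,a) = B(c,a,b) + B(c,b,a) - 2 θ(c) g₀(a,b)`. With `a = v` this yields `A(c,v,b) =
B(c,v,b)`; then `c = v` yields `θ(v) g₀(a,b) = 0` (`recurrence_mul_inducedMetric_eq_zero`). Where
`g₀` vanishes at a point, it vanishes everywhere, and uniqueness of the Weyl form gives `θ = 0`.

Part (ii). The difference `T` of the two torsion-free connections is a symmetric tensor, and a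
Koszul argument determines `g(T(u,v), w)` from `θ` (`difference_koszul`). This fixes `T` modulo the
radical, which is the line spanned by `ξ`; applying `η` reads off the remaining coefficient, and
this is `S` (`exists_isWeylDecomposition`). Conversely, any such decomposition with horizontal `θ`
makes `D` recurrent with form `θ`, so `θ` is the Weyl form, and `S` is then determined because `ξ`
has no zeros. The formulas for `S` follow by applying `η` to the decomposition. -/

noncomputable section

namespace WeylScreen

/-! ### Regularity of contractions of tensor fields with vector fields -/

section Regularity

variable {E : Type*} [NormedAddCommGroup E] [NormedSpace ℝ E]
  {H : Type*} [TopologicalSpace H] {I : ModelWithCorners ℝ E H}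
  {M : Type*} [TopologicalSpace M] [ChartedSpace H M] [IsManifold I 1 M]

theorem OneForm.IsSmooth.contMDiffOn_apply {θ : OneForm I M} (hθ : θ.IsSmooth) {X : VField I M}
    {U : Set M} (hX : X.SmoothOn U) : ContMDiffOn I 𝓘(ℝ, ℝ) ∞ (fun x ↦ θ x (X x)) U := fun x hx ↦
  (contMDiffWithinAt_totalSpace.1 (ContMDiffWithinAt.clm_bundle_apply
    (E₁ := fun x : M ↦ TangentSpace I x) (E₂ := fun _ ↦ ℝ) (b := id) (hθ x).contMDiffWithinAt
    (hX x hx))).2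

theorem OneForm.IsSmooth.contMDiff_apply {θ : OneForm I M} (hθ : θ.IsSmooth) {X : VField I M}
    (hX : X.SmoothOn Set.univ) : ContMDiff I 𝓘(ℝ, ℝ) ∞ (fun x ↦ θ x (X x)) :=
  contMDiffOn_univ.1 (hθ.contMDiffOn_apply hX)

theorem BilinField.IsSmooth.mdifferentiableAt_apply {g : BilinField I M} (hg : g.IsSmooth)
    {X Y : VField I M} {x : M} (hX : X.DiffAt x) (hY : Y.DiffAt x) :
    MDifferentiableAt I 𝓘(ℝ, ℝ) (fun x ↦ g x (X x) (Y x)) x :=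
  ((mdifferentiableAt_totalSpace (E := fun _ : M ↦ ℝ) (F := ℝ) ..).1
    (MDifferentiableAt.clm_bundle_apply₂ (E₁ := fun x : M ↦ TangentSpace I x)
    (E₂ := fun x : M ↦ TangentSpace I x) (E₃ := fun _ : M ↦ ℝ) (b := fun x : M ↦ x) (F₁ := E)
    (F₂ := E) (F₃ := ℝ) ((hg x).mdifferentiableAt (by simp)) hX hY)).2

theorem VField.SmoothOn.diffAt {X : VField I M} {U : Set M} (hX : X.SmoothOn U) {x : M}
    (hU : U ∈ 𝓝 x) : X.DiffAt x :=
  (hX.contMDiffAt hU).mdifferentiableAt (by simp)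

end Regularity

/-! ### Testing smoothness of tensor fields on global smooth vector fields -/

section Smoothness

variable {E : Type*} [NormedAddCommGroup E] [NormedSpace ℝ E]
  {H : Type*} [TopologicalSpace H] {I : ModelWithCorners ℝ E H}
  {M : Type*} [TopologicalSpace M] [ChartedSpace H M]

/-- A map to `E →L[ℝ] F`, with `E` finite-dimensional, is of class `C^k` if all its values are. -/
theorem contMDiffAt_of_forall_clm_apply {V F : Type*} [NormedAddCommGroup V] [NormedSpace ℝ V]
    [FiniteDimensional ℝ V] [NormedAddCommGroup F] [NormedSpace ℝ F] {k : ℕ∞ω}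
    {f : M → V →L[ℝ] F} {x : M}
    (hf : ∀ v, ContMDiffAt I 𝓘(ℝ, F) k (fun y ↦ f y v) x) :
    ContMDiffAt I 𝓘(ℝ, V →L[ℝ] F) k f x := by
  classical
  let b := Module.finBasis ℝ V
  have key : f = fun y ↦ ∑ i, ContinuousLinearMap.smulRightL ℝ V F
      (LinearMap.toContinuousLinearMap (b.coord i)) (f y (b i)) := by
    funext y
    apply ContinuousLinearMap.ext
    intro v
    conv_lhs => rw [← b.sum_repr v, map_sum]
    simp
  rw [key]
  refine contMDiffAt_finsetSum fun i _ ↦ ?_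
  exact ((ContinuousLinearMap.contMDiff _).contMDiffAt).comp x (hf (b i))

theorem contMDiff_trivial_iff {f : M → ℝ} :
    ContMDiff I (I.prod 𝓘(ℝ, ℝ)) ∞ (fun x ↦ TotalSpace.mk' ℝ (E := fun _ : M ↦ ℝ) x (f x)) ↔
      ContMDiff I 𝓘(ℝ, ℝ) ∞ f := by
  refine forall_congr' fun x ↦ ?_
  exact (contMDiffAt_section (E := Bundle.Trivial M ℝ) (F := ℝ) (s := f) x)

variable [FiniteDimensional ℝ E] [IsManifold I ∞ M] [T2Space M]
  {F₂ : Type*} [NormedAddCommGroup F₂] [NormedSpace ℝ F₂] {V₂ : M → Type*}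
  [TopologicalSpace (TotalSpace F₂ V₂)] [∀ x, TopologicalSpace (V₂ x)]
  [∀ x, AddCommGroup (V₂ x)] [∀ x, Module ℝ (V₂ x)]
  [∀ x, IsTopologicalAddGroup (V₂ x)] [∀ x, ContinuousSMul ℝ (V₂ x)]
  [FiberBundle F₂ V₂] [VectorBundle ℝ F₂ V₂]

/-- Every vector field that is smooth on a neighborhood of `x` agrees near `x` with a
globally smooth vector field. -/
theorem exists_contMDiff_eventuallyEq {X : VField I M} {U : Set M} (hU : IsOpen U) {x : M}
    (hx : x ∈ U) (hX : X.SmoothOn U) :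
    ∃ Y : VField I M, Y.SmoothOn Set.univ ∧ ∀ᶠ y in 𝓝 x, Y y = X y := by
  obtain ⟨ψ, -, hψ⟩ := (SmoothBumpFunction.nhds_basis_tsupport (I := I) x).mem_iff.1
    (hU.mem_nhds hx)
  refine ⟨fun y ↦ ψ y • X y, ?_, ?_⟩
  · exact (ContMDiffOn.smul_section_of_tsupport (V := fun y : M ↦ TangentSpace I y)
      ψ.contMDiff.contMDiffOn hU hψ hX).contMDiffOn
  · filter_upwards [ψ.eventuallyEq_one] with y hy
    simp [hy]

/-- A field of linear maps is smooth if it maps smooth vector fields to smooth sections. -/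
theorem contMDiff_hom_of_forall_section (φ : (x : M) → TangentSpace I x →L[ℝ] V₂ x)
    (hφ : ∀ X : VField I M, X.SmoothOn Set.univ →
      ContMDiff I (I.prod 𝓘(ℝ, F₂)) ∞ (fun x ↦ TotalSpace.mk' F₂ x (φ x (X x)))) :
    ContMDiff I (I.prod 𝓘(ℝ, E →L[ℝ] F₂)) ∞
      (fun x ↦ TotalSpace.mk' (E →L[ℝ] F₂)
        (E := fun x : M ↦ TangentSpace I x →L[ℝ] V₂ x) x (φ x)) := by
  intro x
  rw [contMDiffAt_hom_bundle]
  refine ⟨contMDiffAt_id, contMDiffAt_of_forall_clm_apply fun v ↦ ?_⟩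
  -- The test field is the local section with constant coordinate `v` in the trivialization at `x`,
  -- made global by a bump function. Applying `φ` to it gives, near `x`, the coordinate expression
  -- of `φ` evaluated at `v`.
  obtain ⟨s, hs, hsm⟩ := FiberBundle.exists_contMDiffOn_extend (k := ∞) I E
    (V := fun y : M ↦ TangentSpace I y) (x₀ := x)
    ((trivializationAt E (TangentSpace I) x).symm x v)
  obtain ⟨U, hUs, hU, hxU⟩ := mem_nhds_iff.1 hs
  obtain ⟨Y, hY, hYe⟩ := exists_contMDiff_eventuallyEq hU hxU (hsm.mono hUs)
  have h1 := (contMDiffAt_totalSpace.1 (hφ Y hY x)).2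
  refine h1.congr_of_eventuallyEq ?_
  have e1 : ∀ᶠ y in 𝓝 x, y ∈ (trivializationAt E (TangentSpace I) x).baseSet :=
    (trivializationAt E (TangentSpace I) x).open_baseSet.mem_nhds
      (FiberBundle.mem_baseSet_trivializationAt' x)
  have e2 : ∀ᶠ y in 𝓝 x, y ∈ (trivializationAt F₂ V₂ x).baseSet :=
    (trivializationAt F₂ V₂ x).open_baseSet.mem_nhds (FiberBundle.mem_baseSet_trivializationAt' x)
  filter_upwards [hYe, e1, e2] with y hy h1y h2y
  rw [hy]
  simp only [ContinuousLinearMap.inCoordinates_eq h1y h2y]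
  have hv : ((trivializationAt E (TangentSpace I) x)
      ⟨x, (trivializationAt E (TangentSpace I) x).symm x v⟩).2 = v := by
    rw [Trivialization.apply_mk_symm]
    exact FiberBundle.mem_baseSet_trivializationAt' x
  simp [FiberBundle.extend, hv]

/-- A field of linear forms is smooth if its values on smooth vector fields are. -/
theorem OneForm.isSmooth_of_forall (θ : OneForm I M)
    (h : ∀ X : VField I M, X.SmoothOn Set.univ → ContMDiff I 𝓘(ℝ, ℝ) ∞ (fun x ↦ θ x (X x))) :
    θ.IsSmooth :=
  contMDiff_hom_of_forall_section (V₂ := fun _ ↦ ℝ) θ fun X hX ↦ contMDiff_trivial_iff.2 (h X hX)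

/-- A field of bilinear forms is smooth if its values on smooth vector fields are. -/
theorem BilinField.isSmooth_of_forall (S : BilinField I M)
    (h : ∀ X Y : VField I M, X.SmoothOn Set.univ → Y.SmoothOn Set.univ →
      ContMDiff I 𝓘(ℝ, ℝ) ∞ (fun x ↦ S x (X x) (Y x))) :
    S.IsSmooth :=
  contMDiff_hom_of_forall_section (V₂ := fun x : M ↦ TangentSpace I x →L[ℝ] ℝ) S fun X hX ↦
    OneForm.isSmooth_of_forall (fun x ↦ S x (X x)) fun Y hY ↦ h X Y hX hY

end Smoothness

/-! ### Coordinate vector fields of a chart -/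

section CoordinateFields

variable {E : Type*} [NormedAddCommGroup E] [NormedSpace ℝ E]
  {H : Type*} [TopologicalSpace H] {I : ModelWithCorners ℝ E H}
  {M : Type*} [TopologicalSpace M] [ChartedSpace H M]

theorem isInvertible_mfderiv_extend {e : OpenPartialHomeomorph M H}
    (he : e ∈ IsManifold.maximalAtlas I ∞ M) {y : M} (hy : y ∈ e.source) :
    (mfderiv I 𝓘(ℝ, E) (e.extend I) y).IsInvertible := by
  have hd : e.MDifferentiable I I :=
    ⟨(contMDiffOn_of_mem_maximalAtlas he).mdifferentiableOn (by simp),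
      (contMDiffOn_symm_of_mem_maximalAtlas he).mdifferentiableOn (by simp)⟩
  have h : HasMFDerivAt I 𝓘(ℝ, E) (e.extend I) y (mfderiv I I e y) :=
    I.hasMFDerivAt.comp y (hd.mdifferentiableAt hy).hasMFDerivAt
  rw [h.mfderiv]
  exact ⟨hd.mfderiv hy, rfl⟩

variable (I) in
/-- The vector field on the source of the chart `e` whose expression in `e` is constant. -/
def coordField (e : OpenPartialHomeomorph M H) (v : E) : VField I M :=
  mpullback I 𝓘(ℝ, E) (e.extend I) (fun _ ↦ v)

theorem mfderiv_extend_coordField {e : OpenPartialHomeomorph M H}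
    (he : e ∈ IsManifold.maximalAtlas I ∞ M) {y : M} (hy : y ∈ e.source) (v : E) :
    mfderiv I 𝓘(ℝ, E) (e.extend I) y (coordField I e v y) = v :=
  (isInvertible_mfderiv_extend he hy).self_apply_inverse v

theorem diffAt_const (v : E) (z : E) : VField.DiffAt (I := 𝓘(ℝ, E)) (fun _ : E ↦ v) z :=
  (contMDiffAt_vectorSpace_iff_contDiffAt (n := ∞).2 contDiffAt_const).mdifferentiableAt (by simp)

variable [CompleteSpace E] [IsManifold I ∞ M]

theorem diffAt_coordField {e : OpenPartialHomeomorph M H}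
    (he : e ∈ IsManifold.maximalAtlas I ∞ M) {y : M} (hy : y ∈ e.source) (v : E) :
    (coordField I e v).DiffAt y :=
  MDifferentiableAt.mpullback_vectorField (n := ∞) (diffAt_const v _)
    (e.contMDiffAt_extend he hy) (isInvertible_mfderiv_extend he hy) (by norm_cast)

/-- Constant fields on `E` commute, and the Lie bracket is natural under pullback by the extended
chart. -/
theorem mlieBracket_coordField {e : OpenPartialHomeomorph M H}
    (he : e ∈ IsManifold.maximalAtlas I ∞ M) {y : M} (hy : y ∈ e.source) (v w : E) :
    mlieBracket I (coordField I e v) (coordField I e w) y = 0 := by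
  have h2 : minSmoothness ℝ 2 ≤ (∞ : ℕ∞ω) := by
    rw [minSmoothness_of_isRCLikeNormedField]
    norm_cast
  have : IsManifold I (minSmoothness ℝ 2) M := .of_le h2
  let V : VField 𝓘(ℝ, E) E := fun _ ↦ v
  let W : VField 𝓘(ℝ, E) E := fun _ ↦ w
  have h0 : mlieBracket 𝓘(ℝ, E) V W = 0 := by
    rw [← mlieBracketWithin_univ, mlieBracketWithin_eq_lieBracketWithin]
    funext z
    simp [lieBracketWithin, V, W]
    rfl
  have h1 := mpullback_mlieBracket (V := V) (W := W) (n := ∞) (diffAt_const v _)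
    (diffAt_const w _) (e.contMDiffAt_extend he hy) h2
  rw [h0, mpullback_zero] at h1
  exact h1.symm

end CoordinateFields

/-! ### Adapted charts and related fields for an immersion -/

section Immersion

variable {E : Type*} [NormedAddCommGroup E] [NormedSpace ℝ E]
  {H : Type*} [TopologicalSpace H] {I : ModelWithCorners ℝ E H}
  {M : Type*} [TopologicalSpace M] [ChartedSpace H M]
  {E' : Type*} [NormedAddCommGroup E'] [NormedSpace ℝ E']
  {H' : Type*} [TopologicalSpace H'] {I' : ModelWithCorners ℝ E' H'}
  {N : Type*} [TopologicalSpace N] [ChartedSpace H' N]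
  {ι : M → N} {x : M}

/-- The derivative of an immersion in adapted charts is a constant injective linear map. -/
theorem exists_mfderiv_extend_comp_eq (hι : IsImmersionAt I I' ∞ ι x) :
    ∃ e ∈ IsManifold.maximalAtlas I ∞ M, ∃ e' ∈ IsManifold.maximalAtlas I' ∞ N,
      x ∈ e.source ∧ Set.MapsTo ι e.source e'.source ∧ ∃ L : E →L[ℝ] E', Function.Injective L ∧
      ∀ y ∈ e.source, ∀ v : TangentSpace I y,
        mfderiv I' 𝓘(ℝ, E') (e'.extend I') (ι y) (mfderiv I I' ι y v) =
          L (mfderiv I 𝓘(ℝ, E) (e.extend I) y v) := by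
  obtain ⟨F, _, _, hF⟩ := hι
  have hm := hF.mapsto_domChart_source_codChart_source
  -- In adapted charts the immersion is `u ↦ (u, 0)` followed by the linear isomorphism `E × F ≃
  -- E'`; `L` is this map.
  let L : E →L[ℝ] E' := (hF.equiv : E × F →L[ℝ] E').comp (ContinuousLinearMap.inl ℝ E F)
  refine ⟨hF.domChart, hF.domChart_mem_maximalAtlas, hF.codChart, hF.codChart_mem_maximalAtlas,
    hF.mem_domChart_source, hm, L, ?_, ?_⟩
  · intro a b hab
    simpa [L] using hab
  · intro y hy v
    have hιy : MDifferentiableAt I I' ι y :=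
      (hF.contMDiffOn.contMDiffAt (hF.domChart.open_source.mem_nhds hy)).mdifferentiableAt
        (by simp)
    have hc : MDifferentiableAt I' 𝓘(ℝ, E') (hF.codChart.extend I') (ι y) :=
      (hF.codChart.contMDiffAt_extend hF.codChart_mem_maximalAtlas (hm hy)).mdifferentiableAt
        (by simp)
    have hd : MDifferentiableAt I 𝓘(ℝ, E) (hF.domChart.extend I) y :=
      (hF.domChart.contMDiffAt_extend hF.domChart_mem_maximalAtlas hy).mdifferentiableAt
        (by simp)
    have hev : (hF.codChart.extend I') ∘ ι =ᶠ[𝓝 y] L ∘ (hF.domChart.extend I) := by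
      filter_upwards [hF.domChart.open_source.mem_nhds hy] with z hz
      have hz' : z ∈ (hF.domChart.extend I).source := by simpa using hz
      have := hF.writtenInCharts ((hF.domChart.extend I).map_source hz')
      simp only [Function.comp_apply, (hF.domChart.extend I).left_inv hz'] at this
      simpa [L] using this
    have h1 := hev.mfderiv_eq (I := I) (I' := 𝓘(ℝ, E'))
    rw [mfderiv_comp y hc hιy, mfderiv_comp y L.mdifferentiableAt hd] at h1
    have h2 := congrArg (fun A : TangentSpace I y →L[ℝ] E' ↦ A v) h1
    simpa using! h2

theorem mfderiv_injective_of_isImmersionAt (hι : IsImmersionAt I I' ∞ ι x) :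
    Function.Injective (mfderiv I I' ι x) := by
  obtain ⟨e, he, e', -, hx, -, L, hL, h⟩ := exists_mfderiv_extend_comp_eq hι
  intro a b hab
  have := congrArg (mfderiv I' 𝓘(ℝ, E') (e'.extend I') (ι x)) hab
  rw [h x hx, h x hx] at this
  exact (isInvertible_mfderiv_extend he hx).injective (hL this)

/-- Around a point of an immersed manifold, all tangent vectors extend to commuting vector fields
on the manifold that are related to commuting vector fields on the ambient manifold. -/
theorem exists_related_commuting_fields [CompleteSpace E] [IsManifold I ∞ M]
    [CompleteSpace E'] [IsManifold I' ∞ N] (hι : IsImmersionAt I I' ∞ ι x) :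
    ∃ (X : TangentSpace I x → VField I M) (Y : TangentSpace I x → VField I' N),
      (∀ a, X a x = a) ∧ (∀ a, (X a).DiffAt x) ∧ (∀ a, (Y a).DiffAt (ι x)) ∧
      (∀ a, ∀ᶠ y in 𝓝 x, mfderiv I I' ι y (X a y) = Y a (ι y)) ∧
      (∀ a b, mlieBracket I (X a) (X b) x = 0) ∧
      (∀ a b, mlieBracket I' (Y a) (Y b) (ι x) = 0) := by
  obtain ⟨e, he, e', he', hx, hm, L, -, h⟩ := exists_mfderiv_extend_comp_eq hι
  -- In adapted charts the immersion has constant derivative `L`, so it relates the constant field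
  -- `a` to the constant field `L a`.
  refine ⟨fun a ↦ coordField I e (mfderiv I 𝓘(ℝ, E) (e.extend I) x a),
    fun a ↦ coordField I' e' (L (mfderiv I 𝓘(ℝ, E) (e.extend I) x a)), fun a ↦ ?_,
    fun a ↦ diffAt_coordField he hx _, fun a ↦ diffAt_coordField he' (hm hx) _, fun a ↦ ?_,
    fun a b ↦ mlieBracket_coordField he hx _ _, fun a b ↦ mlieBracket_coordField he' (hm hx) _ _⟩
  · exact (isInvertible_mfderiv_extend he hx).injective (mfderiv_extend_coordField he hx _)
  · filter_upwards [e.open_source.mem_nhds hx] with y hy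
    apply (isInvertible_mfderiv_extend he' (hm hy)).injective
    exact (h y hy _).trans ((congrArg L (mfderiv_extend_coordField he hy _)).trans
      (mfderiv_extend_coordField he' (hm hy) _).symm)

end Immersion

/-! ### Conformal change of the degenerate metric -/

section Conformal

variable {E : Type*} [NormedAddCommGroup E] [NormedSpace ℝ E]
  {H : Type*} [TopologicalSpace H] {I : ModelWithCorners ℝ E H}
  {M : Type*} [TopologicalSpace M] [ChartedSpace H M] {g₀ g : BilinField I M}

theorem mem_radical {x : M} {v : TangentSpace I x} : v ∈ radical g x ↔ ∀ w, g x v w = 0 :=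
  Iff.rfl

theorem radical_eq_of_mem_conformalClass (hg : g ∈ conformalClass g₀) :
    radical g = radical g₀ := by
  obtain ⟨f, -, -, hfg⟩ := hg
  funext x
  ext v
  simp [mem_radical, hfg, (Real.exp_pos _).ne']

theorem isSymm_of_mem_conformalClass (h₀ : g₀.IsSymm) (hg : g ∈ conformalClass g₀) :
    g.IsSymm := by
  obtain ⟨f, -, -, hfg⟩ := hg
  intro x u v
  simp [hfg, h₀ x u v]

variable [IsManifold I 1 M]

/-- A connection that is recurrent for a metric conformal to `g₀` is recurrent for `g₀`, with a
`1`-form that has the same values on the radical. -/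
theorem exists_recurrence_of_mem_conformalClass (hg : g ∈ conformalClass g₀) {D : Connection I M}
    {θ : OneForm I M} (hθ : IsRecurrent D g θ) (x : M) :
    ∃ θ₀ : TangentSpace I x →L[ℝ] ℝ, (∀ v ∈ radical g₀ x, θ₀ v = θ x v) ∧
      ∀ Y Z : VField I M, Y.DiffAt x → Z.DiffAt x →
        MDifferentiableAt I 𝓘(ℝ, ℝ) (fun y ↦ g₀ y (Y y) (Z y)) x → ∀ v,
        covDerivMetric D g₀ Y Z x v = -2 * θ₀ v * g₀ x (Y x) (Z x) := by
  obtain ⟨f, hf, hfr, hfg⟩ := hg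
  -- Differentiating `g = e^{-2f} g₀` contributes `-2 df ⊗ g`, whence the form `θ - df`.
  refine ⟨θ x - mvfderiv I f x, fun v hv ↦ by simp [hfr x v hv], fun Y Z hY hZ hm v ↦ ?_⟩
  have h1 := hθ x Y Z hY hZ v
  have hf' : MDifferentiableAt I 𝓘(ℝ, ℝ) f x := (hf x).mdifferentiableAt (by simp)
  have hd : HasDerivAt (fun t : ℝ ↦ Real.exp (-2 * t)) (Real.exp (-2 * f x) * -2) (f x) := by
    simpa using ((hasDerivAt_id (f x)).const_mul (-2)).exp
  have he : HasMFDerivAt I 𝓘(ℝ, ℝ) (fun y ↦ Real.exp (-2 * f y)) x _ :=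
    hd.hasFDerivAt.hasMFDerivAt.comp x hf'.hasMFDerivAt
  have hev : (fun y ↦ g y (Y y) (Z y)) =
      (fun y ↦ Real.exp (-2 * f y)) * fun y ↦ g₀ y (Y y) (Z y) := by
    funext y
    simp [hfg]
  have hev' : mvfderiv I (fun y ↦ Real.exp (-2 * f y)) x v
      = Real.exp (-2 * f x) * -2 * mvfderiv I f x v := by
    simp only [mvfderiv, he.mfderiv]
    exact mul_comm _ _
  have h2 : mvfderiv I (fun y ↦ g y (Y y) (Z y)) x v =
      Real.exp (-2 * f x) * mvfderiv I (fun y ↦ g₀ y (Y y) (Z y)) x v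
        + g₀ x (Y x) (Z x) * (Real.exp (-2 * f x) * -2 * mvfderiv I f x v) := by
    rw [hev, mvfderiv_mul he.mdifferentiableAt hm]
    rw [add_apply, smul_apply, smul_apply, hev']
    rfl
  simp only [covDerivMetric, h2] at h1 ⊢
  have hpos := (Real.exp_pos (-2 * f x)).ne'
  apply mul_left_cancel₀ hpos
  simp [hfg] at h1 ⊢
  linear_combination h1

end Conformal

/-! ### Recurrence forms on a totally geodesic immersed manifold -/

section TotallyGeodesic

variable {E : Type*} [NormedAddCommGroup E] [NormedSpace ℝ E] [FiniteDimensional ℝ E]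
  [CompleteSpace E]
  {H : Type*} [TopologicalSpace H] {I : ModelWithCorners ℝ E H}
  {M : Type*} [TopologicalSpace M] [ChartedSpace H M] [IsManifold I ∞ M]
  {E' : Type*} [NormedAddCommGroup E'] [NormedSpace ℝ E'] [FiniteDimensional ℝ E']
  [CompleteSpace E']
  {H' : Type*} [TopologicalSpace H'] {I' : ModelWithCorners ℝ E' H'}
  {N : Type*} [TopologicalSpace N] [ChartedSpace H' N] [IsManifold I' ∞ N]

theorem IsSymmetricConnection.apply_eq_of_mlieBracket_eq_zero {D : Connection I M}
    (hD : IsSymmetricConnection D) {X Y : VField I M} {x : M} (hX : X.DiffAt x) (hY : Y.DiffAt x)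
    (h : mlieBracket I X Y x = 0) : D Y x (X x) = D X x (Y x) := by
  have := (D.torsion_eq_zero_iff.1 hD.torsion_eq_zero) hX hY
  rwa [h, sub_eq_zero] at this

/-- On a totally geodesic immersed manifold, the recurrence form of a symmetric connection that is
recurrent for the induced metric vanishes on the radical. -/
theorem recurrence_mul_inducedMetric_eq_zero {ι : M → N} {x : M} (hι : IsImmersionAt I I' ∞ ι x)
    {h : BilinField I' N} (hh : h.IsSmooth) (hsymm : h.IsSymm) {Dbar : Connection I' N}
    (hDbar : IsLeviCivita Dbar h) (hgeod : IsTotallyGeodesic I ι Dbar)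
    {D : Connection I M} (hD : IsSymmetricConnection D) {θ : TangentSpace I x →L[ℝ] ℝ}
    (hθ : ∀ Y Z : VField I M, Y.DiffAt x → Z.DiffAt x →
        MDifferentiableAt I 𝓘(ℝ, ℝ) (fun y ↦ inducedMetric (I := I) ι h y (Y y) (Z y)) x → ∀ v,
        covDerivMetric D (inducedMetric ι h) Y Z x v
          = -2 * θ v * inducedMetric (I := I) ι h x (Y x) (Z x))
    {v : TangentSpace I x} (hv : v ∈ radical (inducedMetric (I := I) ι h) x)
    (a b : TangentSpace I x) : θ v * inducedMetric (I := I) ι h x a b = 0 := by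
  obtain ⟨X, Y, hXx, hXd, hYd, hXY, hXb, hYb⟩ := exists_related_commuting_fields hι
  have hιd : MDifferentiableAt I I' ι x := hι.contMDiffAt.mdifferentiableAt (by simp)
  have hYx : ∀ a, Y a (ι x) = mfderiv I I' ι x a := fun a ↦ by
    rw [← (hXY a).self_of_nhds, hXx]
  have hs : ∀ a b, inducedMetric (I := I) ι h x a b = inducedMetric (I := I) ι h x b a :=
    fun a b ↦ hsymm _ _ _
  -- the Christoffel symbols of the two connections
  let A : TangentSpace I x → TangentSpace I x → TangentSpace I x → ℝ := fun c a b ↦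
    h (ι x) (Dbar (Y a) (ι x) (mfderiv I I' ι x c)) (mfderiv I I' ι x b)
  let B : TangentSpace I x → TangentSpace I x → TangentSpace I x → ℝ := fun c a b ↦
    inducedMetric (I := I) ι h x (D (X a) x c) b
  have hA : ∀ c a b, A c a b = A a c b := fun c a b ↦ by
    have := hDbar.symmetric.apply_eq_of_mlieBracket_eq_zero (hYd c) (hYd a) (hYb c a)
    simp only [hYx] at this
    simp only [A, this]
  have hB : ∀ c a b, B c a b = B a c b := fun c a b ↦ by
    have := hD.apply_eq_of_mlieBracket_eq_zero (hXd c) (hXd a) (hXb c a)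
    simp only [hXx] at this
    simp only [B, this]
  -- The ambient derivative of a tangent field stays tangent, and `v` is orthogonal to all tangent
  -- vectors.
  have hAv : ∀ c a, A c a v = 0 := fun c a ↦ by
    obtain ⟨u, hu⟩ := hgeod x (Y a) (hYd a)
      ((hXY a).mono fun y hy ↦ ⟨X a y, hy⟩) c
    simp only [A, ← hu]
    rw [← inducedMetric_apply (I := I), hs]
    exact hv u
  have hBv : ∀ c a, B c a v = 0 := fun c a ↦ by
    simp only [B]
    rw [hs]
    exact hv _
  -- Both sides are the derivative of `g₀(X a, X b)` along `c`: the left by compatibility of `Dbar`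
  -- with `h`, the right by recurrence of `D`.
  have hAB : ∀ c a b, A c a b + A c b a =
      B c a b + B c b a - 2 * θ c * inducedMetric (I := I) ι h x a b := fun c a b ↦ by
    have hev : (fun y ↦ inducedMetric (I := I) ι h y (X a y) (X b y)) =ᶠ[𝓝 x]
        (fun z ↦ h z (Y a z) (Y b z)) ∘ ι := by
      filter_upwards [hXY a, hXY b] with y h1 h2
      rw [inducedMetric_apply, h1, h2]
      rfl
    have hm := hh.mdifferentiableAt_apply (hYd a) (hYd b)
    have h1 := hθ (X a) (X b) (hXd a) (hXd b)
      ((hm.comp x hιd).congr_of_eventuallyEq hev) c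
    have h2 := hDbar.compatible (ι x) (Y a) (Y b) (hYd a) (hYd b) (mfderiv I I' ι x c)
    have h3 : mvfderiv I (fun y ↦ inducedMetric (I := I) ι h y (X a y) (X b y)) x c =
        mvfderiv I' (fun z ↦ h z (Y a z) (Y b z)) (ι x) (mfderiv I I' ι x c) := by
      simp only [mvfderiv, hev.mfderiv_eq, mfderiv_comp x hm hιd]
      rfl
    simp only [covDerivMetric, h3, hXx, hYx] at h1 h2
    rw [hs a] at h1
    rw [hsymm (ι x) (mfderiv I I' ι x a)] at h2
    simp only [A, B]
    linear_combination h1 - h2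
  have hv0 : ∀ b, inducedMetric (I := I) ι h x v b = 0 := hv
  have h1 : ∀ c b, A c v b = B c v b := fun c b ↦ by
    have := hAB c v b
    rw [hAv, hBv, hv0] at this
    linarith
  -- Symmetry moves `v` to the second slot, where `A` and `B` agree by `h1`; only the term in `θ v`
  -- survives.
  have h2 := hAB v a b
  rw [hA v a, hA v b, hB v a, hB v b, h1, h1] at h2
  linarith

end TotallyGeodesic

/-- A nondegenerate bilinear form on a finite-dimensional space represents all linear forms. -/
theorem exists_forall_apply_eq {V : Type*} [AddCommGroup V] [Module ℝ V] [FiniteDimensional ℝ V]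
    (B : V →ₗ[ℝ] V →ₗ[ℝ] ℝ) (hB : ∀ v, (∀ w, B v w = 0) → v = 0) (f : V →ₗ[ℝ] ℝ) :
    ∃ v, ∀ w, B v w = f w := by
  have hinj : Function.Injective B := by
    rw [← LinearMap.ker_eq_bot, LinearMap.ker_eq_bot']
    exact fun v hv ↦ hB v fun w ↦ by simp [hv]
  obtain ⟨v, hv⟩ := (LinearMap.injective_iff_surjective_of_finrank_eq_finrank
    (Subspace.dual_finrank_eq (K := ℝ) (V := V)).symm).1 hinj f
  exact ⟨v, fun w ↦ by rw [hv]⟩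

/-! ### The null transversal field and the form `η` -/

section Transversal

variable {E : Type*} [NormedAddCommGroup E] [NormedSpace ℝ E]
  {H : Type*} [TopologicalSpace H] {I : ModelWithCorners ℝ E H}
  {M : Type*} [TopologicalSpace M] [ChartedSpace H M]
  {E' : Type*} [NormedAddCommGroup E'] [NormedSpace ℝ E'] [FiniteDimensional ℝ E']
  {H' : Type*} [TopologicalSpace H'] {I' : ModelWithCorners ℝ E' H'}
  {N : Type*} [TopologicalSpace N] [ChartedSpace H' N]
  {ι : M → N} {h : BilinField I' N} {Sc : Distribution I M} {ξ : VField I M} {x : M}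

theorem exists_transversal (hsymm : h.IsSymm)
    (hnd : ∀ v : TangentSpace I' (ι x), (∀ w, h (ι x) v w = 0) → v = 0)
    (hι : Function.Injective (mfderiv I I' ι x))
    (hξ : ξ x ∈ radical (inducedMetric (I := I) ι h) x) (hξS : ξ x ∉ Sc x) :
    ∃ T : TangentSpace I' (ι x), h (ι x) T (mfderiv I I' ι x (ξ x)) = 1 ∧ h (ι x) T T = 0 ∧
      ∀ w ∈ Sc x, h (ι x) T (mfderiv I I' ι x w) = 0 := by
  have : FiniteDimensional ℝ (TangentSpace I' (ι x)) := inferInstanceAs (FiniteDimensional ℝ E')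
  obtain ⟨f, hf, hfS⟩ := Submodule.exists_dual_map_eq_bot_of_notMem hξS inferInstance
  obtain ⟨r, hr⟩ := LinearMap.exists_leftInverse_of_injective
    (mfderiv I I' ι x : TangentSpace I x →ₗ[ℝ] TangentSpace I' (ι x)) (LinearMap.ker_eq_bot.2 hι)
  have hr' : ∀ v, r (mfderiv I I' ι x v) = v := fun v ↦ LinearMap.congr_fun hr v
  let B : TangentSpace I' (ι x) →ₗ[ℝ] TangentSpace I' (ι x) →ₗ[ℝ] ℝ :=
    LinearMap.mk₂ ℝ (fun v w ↦ h (ι x) v w) (by simp) (by simp) (by simp) (by simp)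
  obtain ⟨T₀, hT₀⟩ := exists_forall_apply_eq B hnd ((f (ξ x))⁻¹ • f ∘ₗ r)
  have hT : ∀ v, h (ι x) T₀ (mfderiv I I' ι x v) = (f (ξ x))⁻¹ * f v := fun v ↦ by
    simpa [B, hr'] using hT₀ (mfderiv I I' ι x v)
  have hξ' : ∀ w, h (ι x) (mfderiv I I' ι x (ξ x)) (mfderiv I I' ι x w) = 0 := hξ
  have h1 : h (ι x) T₀ (mfderiv I I' ι x (ξ x)) = 1 := by rw [hT, inv_mul_cancel₀ hf]
  -- Since `ξ` is null and orthogonal to the hypersurface, subtracting a multiple of it keeps the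
  -- pairings with tangent vectors. As `h(T₀, ξ) = 1`, half of `h(T₀, T₀)` is the multiple that
  -- makes the result null.
  refine ⟨T₀ - (h (ι x) T₀ T₀ / 2) • mfderiv I I' ι x (ξ x), ?_, ?_, fun w hw ↦ ?_⟩
  · simp [h1, hξ']
  · simp [h1, hξ', hsymm (ι x) (mfderiv I I' ι x (ξ x)) T₀]
    ring
  · have : f w = 0 := by
      have := Submodule.mem_map_of_mem (f := f) hw
      rwa [hfS, Submodule.mem_bot] at this
    simp [hT, this, hξ']

theorem eta_spec (hsymm : h.IsSymm)
    (hnd : ∀ v : TangentSpace I' (ι x), (∀ w, h (ι x) v w = 0) → v = 0)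
    (hι : Function.Injective (mfderiv I I' ι x))
    (hξ : ξ x ∈ radical (inducedMetric (I := I) ι h) x) (hξS : ξ x ∉ Sc x) :
    eta ι h Sc ξ x (ξ x) = 1 ∧ ∀ w ∈ Sc x, eta ι h Sc ξ x w = 0 := by
  have := Classical.epsilon_spec (exists_transversal hsymm hnd hι hξ hξS)
  exact ⟨this.1, this.2.2⟩

end Transversal

/-! ### The musical isomorphism of a normalized pair -/

section Adapted

variable {E : Type*} [NormedAddCommGroup E] [NormedSpace ℝ E]
  {H : Type*} [TopologicalSpace H] {I : ModelWithCorners ℝ E H}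
  {M : Type*} [TopologicalSpace M] [ChartedSpace H M]

/-- The radical of `g` is spanned by `ξ`, and `η(ξ) = 1`. -/
structure IsNormalizedPair (g : BilinField I M) (ξ : VField I M) (η : OneForm I M) : Prop where
  mem_radical : ∀ x, ξ x ∈ radical g x
  apply_eq_one : ∀ x, η x (ξ x) = 1
  eq_smul : ∀ x, ∀ v ∈ radical g x, v = η x v • ξ x

variable {g : BilinField I M} {ξ : VField I M} {η θ : OneForm I M} {x : M}

/-- It suffices that `flat` is onto, hence, by dimension, that it is injective: if `v^♭ = 0`,
evaluation at `ξ` gives `η(v) = 0`, so `v` is radical and `v = η(v) ξ = 0`. -/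
theorem IsNormalizedPair.flat_sharp [FiniteDimensional ℝ E] (hp : IsNormalizedPair g ξ η)
    (hs : g.IsSymm) (v : TangentSpace I x) :
    g x (sharp g η θ x) v + η x (sharp g η θ x) * η x v = θ x v := by
  have : FiniteDimensional ℝ (TangentSpace I x) := inferInstanceAs (FiniteDimensional ℝ E)
  let B : TangentSpace I x →ₗ[ℝ] TangentSpace I x →ₗ[ℝ] ℝ :=
    LinearMap.mk₂ ℝ (fun v w ↦ flat g η x v w) (by intros; simp [flat]; ring)
      (by intros; simp [flat]; ring) (by simp) (by simp)
  have hB : ∀ v, (∀ w, B v w = 0) → v = 0 := fun v hv ↦ by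
    have hv' : ∀ w, g x v w + η x v * η x w = 0 := fun w ↦ by simpa [B, flat] using hv w
    have h1 : η x v = 0 := by
      have := hv' (ξ x)
      rwa [hs, hp.mem_radical x v, hp.apply_eq_one, zero_add, mul_one] at this
    rw [hp.eq_smul x v fun w ↦ by simpa [h1] using hv' w, h1, zero_smul]
  obtain ⟨u, hu⟩ := exists_forall_apply_eq B hB (θ x : TangentSpace I x →ₗ[ℝ] ℝ)
  have h2 : flat g η x (sharp g η θ x) = θ x :=
    Function.invFun_eq ⟨u, ContinuousLinearMap.ext hu⟩
  simpa [flat] using congrArg (fun A : TangentSpace I x →L[ℝ] ℝ ↦ A v) h2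

/-- Evaluate the identity defining `θ^♯` at `ξ`, where both `g` and `θ` vanish. -/
theorem IsNormalizedPair.apply_sharp [FiniteDimensional ℝ E] (hp : IsNormalizedPair g ξ η)
    (hs : g.IsSymm) (hθ : θ.IsHorizontal g) : η x (sharp g η θ x) = 0 := by
  have := hp.flat_sharp (θ := θ) hs (ξ x)
  rwa [hs, hp.mem_radical x _, hp.apply_eq_one, hθ x _ (hp.mem_radical x), zero_add,
    mul_one] at this

theorem IsNormalizedPair.metric_sharp [FiniteDimensional ℝ E] (hp : IsNormalizedPair g ξ η)
    (hs : g.IsSymm) (hθ : θ.IsHorizontal g) (v : TangentSpace I x) :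
    g x (sharp g η θ x) v = θ x v := by
  simpa [hp.apply_sharp hs hθ] using hp.flat_sharp (θ := θ) hs v

end Adapted

/-! ### Smoothness of `η` -/

section ScreenSmooth

variable {E : Type*} [NormedAddCommGroup E] [NormedSpace ℝ E]
  {H : Type*} [TopologicalSpace H] {I : ModelWithCorners ℝ E H}
  {M : Type*} [TopologicalSpace M] [ChartedSpace H M]

/-- A field of linear maps is of class `C^k` if its compositions with an invertible `C^k` field
are. -/
theorem contMDiffAt_of_comp_isInvertible {G V F : Type*} [NormedAddCommGroup G] [NormedSpace ℝ G]
    [NormedAddCommGroup V] [NormedSpace ℝ V] [CompleteSpace G] [NormedAddCommGroup F]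
    [NormedSpace ℝ F] {k : ℕ∞ω} {L : M → V →L[ℝ] F} {A : M → G →L[ℝ] V} {x : M}
    (hA : ContMDiffAt I 𝓘(ℝ, G →L[ℝ] V) k A x) (hx : (A x).IsInvertible)
    (hLA : ContMDiffAt I 𝓘(ℝ, G →L[ℝ] F) k (fun y ↦ (L y).comp (A y)) x) :
    ContMDiffAt I 𝓘(ℝ, V →L[ℝ] F) k L x := by
  have hinv : ContMDiffAt I 𝓘(ℝ, V →L[ℝ] G) k (fun y ↦ (A y).inverse) x :=
    (hx.contDiffAt_map_inverse.contMDiffAt).comp x hA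
  refine (hLA.clm_comp hinv).congr_of_eventuallyEq ?_
  obtain ⟨e, he⟩ := hx
  -- Invertibility is an open condition, so `L = (L ∘ A) ∘ A⁻¹` near `x`.
  have : ∀ᶠ B in 𝓝 (A x), ∃ e : G ≃L[ℝ] V, (e : G →L[ℝ] V) = B := by
    rw [← he]
    exact ContinuousLinearEquiv.nhds e
  filter_upwards [hA.continuousAt.eventually this] with y hy
  obtain ⟨e, he⟩ := hy
  ext v
  simp [← he]

/-- A local frame of the screen together with `ξ` is a smooth frame of the tangent bundle, in which
`η` has the constant coordinates `(0, …, 0, 1)`. -/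
theorem OneForm.isSmooth_of_screen [FiniteDimensional ℝ E] [IsManifold I 1 M] {n : ℕ}
    (hn : Module.finrank ℝ E = n + 1)
    {Sc : Distribution I M} (hSc : Sc.IsSmoothOfRank n) {ξ : VField I M}
    (hξ : ξ.SmoothOn Set.univ) {η : OneForm I M}
    (hηξ : ∀ x, η x (ξ x) = 1) (hηS : ∀ x, ∀ w ∈ Sc x, η x w = 0) : η.IsSmooth := by
  intro x
  obtain ⟨U, hU, hxU, s, hs, hsp⟩ := hSc x
  let e := trivializationAt E (TangentSpace I : M → Type _) x
  have hxe : x ∈ e.baseSet := FiberBundle.mem_baseSet_trivializationAt' x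
  rw [contMDiffAt_hom_bundle]
  refine ⟨contMDiffAt_id, ?_⟩
  let P : Fin n → (Fin n → ℝ) × ℝ →L[ℝ] ℝ := fun i ↦
    (ContinuousLinearMap.proj i).comp (ContinuousLinearMap.fst ℝ (Fin n → ℝ) ℝ)
  let A : M → (Fin n → ℝ) × ℝ →L[ℝ] E := fun y ↦
    ∑ i, (P i).smulRight (e ⟨y, s i y⟩).2
      + (ContinuousLinearMap.snd ℝ (Fin n → ℝ) ℝ).smulRight (e ⟨y, ξ y⟩).2
  have hA : ContMDiffAt I 𝓘(ℝ, (Fin n → ℝ) × ℝ →L[ℝ] E) ∞ A x := by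
    have key : ∀ (p : (Fin n → ℝ) × ℝ →L[ℝ] ℝ) (X : VField I M),
        ContMDiffAt I (I.prod 𝓘(ℝ, E)) ∞ (fun y ↦ (⟨y, X y⟩ : TangentBundle I M)) x →
        ContMDiffAt I 𝓘(ℝ, (Fin n → ℝ) × ℝ →L[ℝ] E) ∞
          (fun y ↦ p.smulRight (e ⟨y, X y⟩).2) x := fun p X hX ↦
      ((ContinuousLinearMap.smulRightL ℝ ((Fin n → ℝ) × ℝ) E p).contMDiff.contMDiffAt).comp x
        (contMDiffAt_totalSpace.1 hX).2
    exact (contMDiffAt_finsetSum fun i _ ↦ key _ _ ((hs i).contMDiffAt (hU.mem_nhds hxU))).add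
      (key _ _ (hξ.contMDiffAt Filter.univ_mem))
  have hAe : ∀ y ∈ e.baseSet, ∀ c, A y c =
      e.continuousLinearMapAt ℝ y (∑ i, c.1 i • s i y + c.2 • ξ y) := fun y hy c ↦ by
    have hm : ∀ v, (e ⟨y, v⟩).2 = e.continuousLinearMapAt ℝ y v := fun v ↦
      congrFun (e.coe_continuousLinearEquivAt_eq (R := ℝ) hy) v
    simp [A, P, hm]
  refine contMDiffAt_of_comp_isInvertible hA ?_ ?_
  · have hinj : Function.Injective (A x) := by
      rw [injective_iff_map_eq_zero]
      intro c hc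
      rw [hAe x hxe] at hc
      have hc' : ∑ i, c.1 i • s i x + c.2 • ξ x = 0 :=
        (e.continuousLinearEquivAt ℝ x hxe).injective <| by
          rw [map_zero, e.coe_continuousLinearEquivAt_eq hxe]
          exact hc
      have hsS : ∑ i, c.1 i • s i x ∈ Sc x := by
        rw [← (hsp x hxU).2]
        exact Submodule.sum_mem _ fun i _ ↦
          Submodule.smul_mem _ _ (Submodule.subset_span ⟨i, rfl⟩)
      have h2 : c.2 = 0 := by
        have := congrArg (η x) hc'
        simpa [-map_sum, hηS x _ hsS, hηξ] using this
      have h1 : c.1 = 0 := by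
        funext i
        rw [h2, zero_smul, add_zero] at hc'
        exact Fintype.linearIndependent_iff.1 (hsp x hxU).1 c.1 hc' i
      exact Prod.ext h1 h2
    let A' := LinearEquiv.ofInjectiveOfFinrankEq (A x : (Fin n → ℝ) × ℝ →ₗ[ℝ] E) hinj
      (by simp [hn])
    exact ⟨A'.toContinuousLinearEquiv, by ext c <;> rfl⟩
  · refine (contMDiffAt_const (c := ContinuousLinearMap.snd ℝ (Fin n → ℝ) ℝ)).congr_of_eventuallyEq
      ?_
    filter_upwards [hU.mem_nhds hxU, e.open_baseSet.mem_nhds hxe] with y hyU hye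
    apply ContinuousLinearMap.ext
    intro c
    have hsS : ∑ i, c.1 i • s i y ∈ Sc y := by
      rw [← (hsp y hyU).2]
      exact Submodule.sum_mem _ fun i _ ↦ Submodule.smul_mem _ _ (Submodule.subset_span ⟨i, rfl⟩)
    rw [ContinuousLinearMap.comp_apply, hAe y hye]
    change (trivializationAt ℝ (Bundle.Trivial M ℝ) x).continuousLinearMapAt ℝ y
      (η y (e.symmL ℝ y (e.continuousLinearMapAt ℝ y _))) = c.2
    rw [e.symmL_continuousLinearMapAt hye, map_add, map_smul, hηS y _ hsS, hηξ]
    simp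

end ScreenSmooth

/-! ### The difference tensor and the Weyl decomposition -/

section Difference

variable {E : Type*} [NormedAddCommGroup E] [NormedSpace ℝ E]
  {H : Type*} [TopologicalSpace H] {I : ModelWithCorners ℝ E H}
  {M : Type*} [TopologicalSpace M] [ChartedSpace H M] [IsManifold I ∞ M]
  {D Dg : Connection I M} {g : BilinField I M} {ξ : VField I M} {η θ : OneForm I M}
  {S : BilinField I M}

variable (I) in
theorem exists_diffAt_eq {x : M} (u : TangentSpace I x) : ∃ X : VField I M, X.DiffAt x ∧ X x = u :=
  ⟨FiberBundle.extend E u, FiberBundle.mdifferentiableAt_extend I E u, by simp⟩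

/-- The bilinear form in the Weyl decomposition is determined by the `1`-form. -/
theorem IsWeylDecomposition.unique {S' : BilinField I M} (hξ : ∀ x, ξ x ≠ 0)
    (hdec : IsWeylDecomposition D Dg g η ξ θ S) (hdec' : IsWeylDecomposition D Dg g η ξ θ S') :
    S' = S := by
  funext x
  ext u v
  obtain ⟨Y, hY, rfl⟩ := exists_diffAt_eq I v
  have h := (hdec' x Y hY u).symm.trans (hdec x Y hY u)
  exact smul_left_injective ℝ (hξ x) (sub_right_injective h)

/-- The radical is spanned by `ξ`, so only `S(ξ, ξ)` matters; it is found by applying `η` to the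
decomposition of `D_ξ ξ`. -/
theorem IsWeylDecomposition.apply_eq_zero_of_mem_radical (hp : IsNormalizedPair g ξ η)
    (hθ : θ.IsHorizontal g) (hξd : ∀ x, ξ.DiffAt x)
    (hdec : IsWeylDecomposition D Dg g η ξ θ S) (h1 : ∀ x, D ξ x (ξ x) = 0)
    (h2 : ∀ x, Dg ξ x (ξ x) = 0) (x : M) (u : TangentSpace I x) (hu : u ∈ radical g x)
    (v : TangentSpace I x) (hv : v ∈ radical g x) : S x u v = 0 := by
  have h := congrArg (η x) (hdec x ξ (hξd x) (ξ x))
  have hg : g x (ξ x) (ξ x) = 0 := hp.mem_radical x _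
  simp only [h1, h2, hg, hθ x _ (hp.mem_radical x), zero_smul, map_zero, map_sub, map_add,
    map_smul, smul_eq_mul, hp.apply_eq_one] at h
  have hS : S x (ξ x) (ξ x) = 0 := by linarith
  rw [hp.eq_smul x u hu, hp.eq_smul x v hv]
  simp [hS]

variable [FiniteDimensional ℝ E]

/-- The difference of two connections is given by a field of bilinear maps. -/
theorem exists_difference (D Dg : Connection I M) :
    ∃ T : (x : M) → TangentSpace I x →L[ℝ] TangentSpace I x →L[ℝ] TangentSpace I x,
      ∀ (x : M) (Y : VField I M), Y.DiffAt x → ∀ v, T x (Y x) v = D Y x v - Dg Y x v := by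
  have : ContMDiffVectorBundle 1 E (TangentSpace I : M → Type _) I := inferInstance
  refine ⟨IsCovariantDerivativeOn.difference D.isCovariantDerivativeOnUniv
    Dg.isCovariantDerivativeOnUniv, fun x Y hY v ↦ ?_⟩
  rw [IsCovariantDerivativeOn.difference_apply D.isCovariantDerivativeOnUniv
    Dg.isCovariantDerivativeOnUniv trivial hY]
  rfl

/-- A connection with a Weyl decomposition is recurrent. -/
theorem IsWeylDecomposition.isRecurrent (hs : g.IsSymm) (hp : IsNormalizedPair g ξ η)
    (hc : IsCompatible Dg g) (hθ : θ.IsHorizontal g)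
    (hdec : IsWeylDecomposition D Dg g η ξ θ S) : IsRecurrent D g θ := by
  intro x Y Z hY hZ v
  have h2 := hc x Y Z hY hZ v
  have hξ : ∀ w, g x (ξ x) w = 0 := hp.mem_radical x
  have hξ' : ∀ w, g x w (ξ x) = 0 := fun w ↦ by rw [hs, hξ]
  have hsh : ∀ w, g x w (sharp g η θ x) = θ x w := fun w ↦ by rw [hs, hp.metric_sharp hs hθ]
  simp only [covDerivMetric, hdec x Y hY, hdec x Z hZ] at h2 ⊢
  -- The `ξ` terms drop out, and the `θ^♯` terms cancel against those with `θ(Y)` and `θ(Z)`,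
  -- leaving `2 θ(v) g(Y, Z)`.
  simp only [map_add, map_sub, map_smul, add_apply, sub_apply, smul_apply, smul_eq_mul, hξ, hξ',
    hsh, hp.metric_sharp hs hθ]
  rw [hs x (Y x) v]
  linear_combination h2

/-- Apply `η` to the decomposition: `Y`, `D_v Y` and `θ^♯` are all killed, the second because the
screen is parallel. -/
theorem IsWeylDecomposition.apply_eq_screenForm (hs : g.IsSymm) (hp : IsNormalizedPair g ξ η)
    (hθ : θ.IsHorizontal g) {Sc : Distribution I M} (hηS : ∀ x, ∀ w ∈ Sc x, η x w = 0)
    (hpar : Sc.IsParallel D) (hdec : IsWeylDecomposition D Dg g η ξ θ S) (x : M) (Y : VField I M)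
    (hY : Y.DiffAt x) (hYS : ∀ᶠ y in 𝓝 x, Y y ∈ Sc y) (v : TangentSpace I x) :
    S x v (Y x) = screenForm Dg η Y x v + η x v * θ x (Y x) := by
  have h := congrArg (η x) (hdec x Y hY v)
  simp only [hηS x _ (hpar x Y hY hYS v), hηS x _ hYS.self_of_nhds, map_sub, map_add,
    map_smul, smul_eq_mul, hp.apply_eq_one, hp.apply_sharp hs hθ] at h
  rw [screenForm]
  linarith

variable [CompleteSpace E]

theorem IsSymmetricConnection.smoothOn_apply (hD : IsSymmetricConnection D) {X Y : VField I M}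
    (hX : X.SmoothOn Set.univ) (hY : Y.SmoothOn Set.univ) :
    VField.SmoothOn (fun x ↦ D Y x (X x)) Set.univ :=
  ContMDiffOn.clm_bundle_apply (E₁ := fun x : M ↦ TangentSpace I x)
    (E₂ := fun x : M ↦ TangentSpace I x) (b := fun x : M ↦ x)
    (hD.smooth.contMDiff (σ := Y) hY) hX

theorem difference_symm (hD : IsSymmetricConnection D) (hDg : IsSymmetricConnection Dg)
    {T : (x : M) → TangentSpace I x →L[ℝ] TangentSpace I x →L[ℝ] TangentSpace I x}
    (hT : ∀ (x : M) (Y : VField I M), Y.DiffAt x → ∀ v, T x (Y x) v = D Y x v - Dg Y x v)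
    (x : M) (u v : TangentSpace I x) : T x u v = T x v u := by
  obtain ⟨X, hX, rfl⟩ := exists_diffAt_eq I u
  obtain ⟨Y, hY, rfl⟩ := exists_diffAt_eq I v
  have h1 := (D.torsion_eq_zero_iff.1 hD.torsion_eq_zero) hX hY
  have h2 := (Dg.torsion_eq_zero_iff.1 hDg.torsion_eq_zero) hX hY
  rw [hT x X hX, hT x Y hY]
  rw [← h2] at h1
  rw [sub_eq_sub_iff_add_eq_add] at h1 ⊢
  rw [add_comm, ← h1]

/-- The Koszul formula for the difference of a recurrent and a compatible connection. -/
theorem difference_koszul (hs : g.IsSymm) (hD : IsSymmetricConnection D)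
    (hDg : IsSymmetricConnection Dg) (hθ : IsRecurrent D g θ) (hc : IsCompatible Dg g)
    {T : (x : M) → TangentSpace I x →L[ℝ] TangentSpace I x →L[ℝ] TangentSpace I x}
    (hT : ∀ (x : M) (Y : VField I M), Y.DiffAt x → ∀ v, T x (Y x) v = D Y x v - Dg Y x v)
    (x : M) (u v w : TangentSpace I x) :
    g x (T x u v) w = θ x u * g x v w + θ x v * g x u w - θ x w * g x u v := by
  have hsym := difference_symm hD hDg hT x
  -- This is the difference of the two covariant derivatives of `g`; the Koszul alternation of its
  -- cyclic versions then isolates `T u v`.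
  have key : ∀ a b c : TangentSpace I x,
      g x (T x b a) c + g x (T x c a) b = 2 * θ x a * g x b c := fun a b c ↦ by
    obtain ⟨Y, hY, rfl⟩ := exists_diffAt_eq I b
    obtain ⟨Z, hZ, rfl⟩ := exists_diffAt_eq I c
    have h1 := hθ x Y Z hY hZ a
    have h2 := hc x Y Z hY hZ a
    rw [hs x (T x (Z x) a), hT x Y hY, hT x Z hZ, map_sub, map_sub, sub_apply]
    simp only [covDerivMetric] at h1 h2
    linear_combination h2 - h1
  have h1 := key u v w
  have h2 := key v u w
  have h3 := key w u v
  rw [hsym v u, hsym w u] at h1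
  rw [hsym w v] at h2
  linear_combination (h1 + h2 - h3) / 2

/-- The symmetric bilinear form in the Weyl decomposition. -/
theorem exists_isWeylDecomposition [T2Space M] (hs : g.IsSymm) (hp : IsNormalizedPair g ξ η)
    (hD : IsSymmetricConnection D) (hDg : IsSymmetricConnection Dg) (hc : IsCompatible Dg g)
    (hη : η.IsSmooth) (hθs : θ.IsSmooth) (hθ : θ.IsHorizontal g) (hrec : IsRecurrent D g θ) :
    ∃ S : BilinField I M, S.IsSmooth ∧ S.IsSymm ∧ IsWeylDecomposition D Dg g η ξ θ S := by
  obtain ⟨T, hT⟩ := exists_difference D Dg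
  have hsym := difference_symm hD hDg hT
  have hK := difference_koszul hs hD hDg hrec hc hT
  -- The formula for `S` is forced by applying `η` to the desired decomposition, since `η(ξ) = 1`
  -- and `η(θ^♯) = 0`.
  have hex : ∀ x, ∃ B : TangentSpace I x →L[ℝ] TangentSpace I x →L[ℝ] ℝ, ∀ u v,
      B u v = θ x u * η x v + θ x v * η x u - η x (T x u v) := fun x ↦
    let P : TangentSpace I x →L[ℝ] TangentSpace I x →L[ℝ] ℝ :=
      (ContinuousLinearMap.compL ℝ E E ℝ (η x)).comp (T x)
    ⟨(θ x).smulRight (η x) + (η x).smulRight (θ x) - P, fun u v ↦ by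
      rw [mul_comm (θ x v)]
      rfl⟩
  choose S hS using hex
  refine ⟨S, ?_, fun x u v ↦ ?_, fun x Y hY v ↦ ?_⟩
  · refine BilinField.isSmooth_of_forall S fun X Y hX hY ↦ ?_
    have h1 : (fun x ↦ S x (X x) (Y x)) = fun x ↦ θ x (X x) * η x (Y x) + θ x (Y x) * η x (X x)
        - (η x (D X x (Y x)) - η x (Dg X x (Y x))) := by
      funext x
      rw [hS, hT x X (hX.diffAt Filter.univ_mem), map_sub]
    rw [h1]
    exact (((hθs.contMDiff_apply hX).mul (hη.contMDiff_apply hY)).add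
      ((hθs.contMDiff_apply hY).mul (hη.contMDiff_apply hX))).sub
      ((hη.contMDiff_apply (hD.smoothOn_apply hY hX)).sub
        (hη.contMDiff_apply (hDg.smoothOn_apply hY hX)))
  · rw [hS, hS, hsym x u v]
    ring
  -- `R` is what must equal `-S(v, Y) ξ`. The Koszul formula puts it in the radical, so `η`
  -- determines it.
  · let R : TangentSpace I x := T x (Y x) v - θ x v • Y x - θ x (Y x) • v
      + g x v (Y x) • sharp g η θ x
    have hR : R ∈ radical g x := fun w ↦ by
      simp only [R, map_add, map_sub, map_smul, add_apply, sub_apply, smul_apply, smul_eq_mul,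
        hp.metric_sharp hs hθ, hK]
      rw [hs x v (Y x)]
      ring
    have hηR : η x R = - S x v (Y x) := by
      simp only [R, map_add, map_sub, map_smul, smul_eq_mul, hp.apply_sharp hs hθ, hS,
        hsym x v (Y x)]
      ring
    have h1 := hp.eq_smul x R hR
    rw [hηR] at h1
    have h2 : D Y x v = Dg Y x v + T x (Y x) v := by rw [hT x Y hY]; abel
    have h3 : T x (Y x) v = R + θ x v • Y x + θ x (Y x) • v - g x v (Y x) • sharp g η θ x := by
      simp only [R]
      abel
    rw [h2, h3, h1]
    module

end Difference

/-! ### Rank of the screen and of the radical -/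

section Screen

variable {E : Type*} [NormedAddCommGroup E] [NormedSpace ℝ E]
  {H : Type*} [TopologicalSpace H] {I : ModelWithCorners ℝ E H}
  {M : Type*} [TopologicalSpace M] [ChartedSpace H M] [IsManifold I 1 M] {n : ℕ}
  {g : BilinField I M} {Sc : Distribution I M} {ξ : VField I M} {η : OneForm I M}

theorem IsScreenDistribution.finrank_eq (hSc : IsScreenDistribution n g Sc) (x : M) :
    Module.finrank ℝ (Sc x) = n := by
  obtain ⟨U, -, hxU, s, -, hs⟩ := hSc.smooth x
  rw [← (hs x hxU).2, finrank_span_eq_card (hs x hxU).1, Fintype.card_fin]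

theorem IsScreenDistribution.notMem (hSc : IsScreenDistribution n g Sc) {x : M}
    (hξ : ξ x ∈ radical g x) (hξ0 : ξ x ≠ 0) : ξ x ∉ Sc x := fun h ↦
  hξ0 (Submodule.disjoint_def.1 (hSc.isCompl x).disjoint _ h hξ)

variable [FiniteDimensional ℝ E]

/-- On a manifold of dimension `n + 1` with a screen distribution of rank `n`, a section `ξ` of
the radical and a form `η` with `η(ξ) = 1` are a normalized pair. -/
theorem IsScreenDistribution.isNormalizedPair (hSc : IsScreenDistribution n g Sc)
    (hn : Module.finrank ℝ E = n + 1) (hξ : ∀ x, ξ x ∈ radical g x)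
    (hη : ∀ x, η x (ξ x) = 1) : IsNormalizedPair g ξ η := by
  refine ⟨hξ, hη, fun x v hv ↦ ?_⟩
  have : FiniteDimensional ℝ (TangentSpace I x) := inferInstanceAs (FiniteDimensional ℝ E)
  have h1 := Submodule.finrank_add_eq_of_isCompl (hSc.isCompl x)
  have h2 : Module.finrank ℝ (TangentSpace I x) = n + 1 := hn
  rw [hSc.finrank_eq, h2] at h1
  have h3 : Module.finrank ℝ (radical g x) = 1 := by omega
  have hξ0 : (⟨ξ x, hξ x⟩ : radical g x) ≠ 0 := fun h ↦ by
    have h0 : ξ x = 0 := congrArg Subtype.val h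
    have := hη x
    rw [h0, map_zero] at this
    exact zero_ne_one this
  obtain ⟨c, hc⟩ := (finrank_eq_one_iff_of_nonzero' _ hξ0).1 h3 ⟨v, hv⟩
  have hc' : c • ξ x = v := congrArg Subtype.val hc
  rw [← hc', map_smul, hη, smul_eq_mul, mul_one]

/-- If the metric vanishes at one point, then the screen distribution has rank `0`, and the metric
vanishes everywhere. -/
theorem IsScreenDistribution.eq_zero_of_apply_eq_zero (hSc : IsScreenDistribution n g Sc) {x : M}
    (hx : ∀ u v, g x u v = 0) (y : M) (u v : TangentSpace I y) : g y u v = 0 := by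
  have : FiniteDimensional ℝ (TangentSpace I y) := inferInstanceAs (FiniteDimensional ℝ E)
  have h1 : radical g x = ⊤ := eq_top_iff.2 fun u _ v ↦ hx u v
  have h2 : Sc x = ⊥ := by
    have := (hSc.isCompl x).disjoint
    rwa [h1, disjoint_top] at this
  have h3 : n = 0 := by rw [← hSc.finrank_eq x, h2, finrank_bot]
  have h4 : Sc y = ⊥ := Submodule.finrank_eq_zero.1 ((hSc.finrank_eq y).trans h3)
  have h5 : radical g y = ⊤ := by
    have := (hSc.isCompl y).codisjoint
    rwa [h4, bot_codisjoint] at this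
  have h6 : u ∈ radical g y := h5 ▸ Submodule.mem_top
  exact h6 v

end Screen

/-! ### Part (i): horizontality -/

section Horizontal

variable {E : Type*} [NormedAddCommGroup E] [NormedSpace ℝ E] [FiniteDimensional ℝ E]
  [CompleteSpace E]
  {H : Type*} [TopologicalSpace H] {I : ModelWithCorners ℝ E H}
  {M : Type*} [TopologicalSpace M] [ChartedSpace H M] [IsManifold I ∞ M]
  {E' : Type*} [NormedAddCommGroup E'] [NormedSpace ℝ E'] [FiniteDimensional ℝ E']
  [CompleteSpace E']
  {H' : Type*} [TopologicalSpace H'] {I' : ModelWithCorners ℝ E' H'}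
  {N : Type*} [TopologicalSpace N] [ChartedSpace H' N] [IsManifold I' ∞ N] {n : ℕ}

/-- The recurrence forms of a Weyl structure on a totally geodesic lightlike hypersurface with a
screen distribution are horizontal. -/
theorem IsWeylStructure.isHorizontal {h : BilinField I' N} (hh : IsPseudoRiemannianMetric h)
    {Dbar : Connection I' N} (hDbar : IsLeviCivita Dbar h) {ι : M → N}
    (hι : IsImmersion I I' ∞ ι) (hgeod : IsTotallyGeodesic I ι Dbar) {Sc : Distribution I M}
    (hSc : IsScreenDistribution n (inducedMetric (I := I) ι h) Sc) {D : Connection I M}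
    (hD : IsWeylStructure (conformalClass (inducedMetric (I := I) ι h)) D) {g : BilinField I M}
    (hg : g ∈ conformalClass (inducedMetric (I := I) ι h)) {θ : OneForm I M} (hθ : θ.IsSmooth)
    (hrec : IsRecurrent D g θ) : θ.IsHorizontal g := by
  intro x v hv
  rw [radical_eq_of_mem_conformalClass hg] at hv
  by_cases h0 : ∀ a b, inducedMetric (I := I) ι h x a b = 0
  -- Here the recurrence condition for the zero metric no longer involves the form, so the zero form
  -- satisfies it too, and uniqueness applies.
  · have hg0 : ∀ (y : M) (u w : TangentSpace I y), g y u w = 0 := by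
      obtain ⟨f, -, -, hfg⟩ := hg
      intro y u w
      simp [hfg, hSc.eq_zero_of_apply_eq_zero h0 y u w]
    have hz : OneForm.IsSmooth (fun _ ↦ 0 : OneForm I M) :=
      contMDiff_zeroSection ℝ (fun x : M ↦ TangentSpace I x →L[ℝ] ℝ)
    have hzr : IsRecurrent D g (fun _ ↦ 0 : OneForm I M) := by
      intro y Y Z hY hZ w
      rw [hrec y Y Z hY hZ w, hg0]
      simp
    rw [(hD.existsUnique g hg).unique ⟨hθ, hrec⟩ ⟨hz, hzr⟩]
    rfl
  · push Not at h0
    obtain ⟨a, b, hab⟩ := h0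
    obtain ⟨θ₀, hθ₀, hr⟩ := exists_recurrence_of_mem_conformalClass hg hrec x
    rw [← hθ₀ v hv]
    exact (mul_eq_zero.1 (recurrence_mul_inducedMetric_eq_zero (hι.isImmersionAt x) hh.smooth
      hh.symm hDbar hgeod hD.symmetric hr hv a b)).resolve_right hab

end Horizontal

end WeylScreen

end

/-! ### The main theorem -/

theorem mainTheorem4 (n : ℕ)
    {M : Type*} [TopologicalSpace M] [T2Space M]
    [ChartedSpace (EuclideanSpace ℝ (Fin (n + 1))) M] [IsManifold (𝓡 (n + 1)) ∞ M]
    {N : Type*} [TopologicalSpace N] [T2Space N]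
    [ChartedSpace (EuclideanSpace ℝ (Fin (n + 2))) N] [IsManifold (𝓡 (n + 2)) ∞ N]
    -- the ambient metric and its Levi-Civita connection
    (h : WeylScreen.BilinField (𝓡 (n + 2)) N) (hh : WeylScreen.IsPseudoRiemannianMetric h)
    (Dbar : WeylScreen.Connection (𝓡 (n + 2)) N) (hDbar : WeylScreen.IsLeviCivita Dbar h)
    -- the totally geodesic lightlike hypersurface, with its induced metric
    (ι : M → N) (hι : Manifold.IsImmersion (𝓡 (n + 1)) (𝓡 (n + 2)) ∞ ι)
    (hgeod : WeylScreen.IsTotallyGeodesic (𝓡 (n + 1)) ι Dbar)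
    (g₀ : WeylScreen.BilinField (𝓡 (n + 1)) M) (hg₀ : g₀ = WeylScreen.inducedMetric ι h)
    (hlight : WeylScreen.IsLightlike g₀)
    -- the integrable screen distribution and the Weyl screen structure
    (Sc : WeylScreen.Distribution (𝓡 (n + 1)) M)
    (hSc : WeylScreen.IsScreenDistribution n g₀ Sc) (hint : Sc.IsIntegrable)
    (D : WeylScreen.Connection (𝓡 (n + 1)) M)
    (hD : WeylScreen.IsWeylScreenStructure (WeylScreen.conformalClass g₀) Sc D) :
    (∀ g ∈ WeylScreen.conformalClass g₀, ∀ θ : WeylScreen.OneForm (𝓡 (n + 1)) M,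
      θ.IsSmooth → WeylScreen.IsRecurrent D g θ → θ.IsHorizontal g) ∧
    (∀ g ∈ WeylScreen.conformalClass g₀,
      -- a nowhere vanishing section `ξ` of the radical distribution
      ∀ ξ : WeylScreen.VField (𝓡 (n + 1)) M, ξ.SmoothOn Set.univ →
      (∀ x, ξ x ∈ WeylScreen.radical g₀ x ∧ ξ x ≠ 0) →
      -- a torsion-free connection `Dg` compatible with `g`
      ∀ Dg : WeylScreen.Connection (𝓡 (n + 1)) M, WeylScreen.IsSymmetricConnection Dg →
      WeylScreen.IsCompatible Dg g →
      ∃ (θ : WeylScreen.OneForm (𝓡 (n + 1)) M) (S : WeylScreen.BilinField (𝓡 (n + 1)) M),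
        (θ.IsSmooth ∧ θ.IsHorizontal g ∧ S.IsSmooth ∧ S.IsSymm ∧
          WeylScreen.IsWeylDecomposition D Dg g (WeylScreen.eta ι h Sc ξ) ξ θ S) ∧
        -- `θ` is the Weyl 1-form of `g`
        WeylScreen.IsRecurrent D g θ ∧
        -- uniqueness of the pair
        (∀ (θ' : WeylScreen.OneForm (𝓡 (n + 1)) M) (S' : WeylScreen.BilinField (𝓡 (n + 1)) M),
          θ'.IsSmooth → θ'.IsHorizontal g → S'.IsSmooth → S'.IsSymm →
          WeylScreen.IsWeylDecomposition D Dg g (WeylScreen.eta ι h Sc ξ) ξ θ' S' →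
          θ' = θ ∧ S' = S) ∧
        -- `S` vanishes on the radical, for `ξ` and `Dg` normalized by `D_ξ ξ = Dg_ξ ξ = 0`
        ((∀ x, D ξ x (ξ x) = 0) → (∀ x, Dg ξ x (ξ x) = 0) →
          ∀ x, ∀ u ∈ WeylScreen.radical g x, ∀ v ∈ WeylScreen.radical g x, S x u v = 0) ∧
        -- `S(X, Y) = C(X, Y) + η(X) θ(Y)` for `Y` in the screen distribution
        (∀ (x : M) (Y : WeylScreen.VField (𝓡 (n + 1)) M), Y.DiffAt x →
          (∀ᶠ y in 𝓝 x, Y y ∈ Sc y) → ∀ v : TangentSpace (𝓡 (n + 1)) x,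
          S x v (Y x) = WeylScreen.screenForm Dg (WeylScreen.eta ι h Sc ξ) Y x v
            + WeylScreen.eta ι h Sc ξ x v * θ x (Y x))) := by
  subst hg₀
  have hhor : ∀ g ∈ WeylScreen.conformalClass (WeylScreen.inducedMetric ι h),
      ∀ θ : WeylScreen.OneForm (𝓡 (n + 1)) M,
      θ.IsSmooth → WeylScreen.IsRecurrent D g θ → θ.IsHorizontal g := fun g hg θ hθ hrec ↦
    hD.weyl.isHorizontal hh hDbar hι hgeod hSc hg hθ hrec
  refine ⟨hhor, fun g hg ξ hξs hξ Dg hDg hc ↦ ?_⟩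
  have hrad := WeylScreen.radical_eq_of_mem_conformalClass hg
  have hs : g.IsSymm :=
    WeylScreen.isSymm_of_mem_conformalClass (fun x u v ↦ hh.symm _ _ _) hg
  have hη : ∀ x, WeylScreen.eta ι h Sc ξ x (ξ x) = 1 ∧
      ∀ w ∈ Sc x, WeylScreen.eta ι h Sc ξ x w = 0 := fun x ↦
    WeylScreen.eta_spec hh.symm (hh.nondegenerate (ι x))
      (WeylScreen.mfderiv_injective_of_isImmersionAt (hι.isImmersionAt x)) (hξ x).1
      (hSc.notMem (hξ x).1 (hξ x).2)
  have hfr : Module.finrank ℝ (EuclideanSpace ℝ (Fin (n + 1))) = n + 1 := by simp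
  have hηs : (WeylScreen.eta ι h Sc ξ).IsSmooth :=
    WeylScreen.OneForm.isSmooth_of_screen hfr hSc.smooth hξs (fun x ↦ (hη x).1) fun x ↦ (hη x).2
  have hp : WeylScreen.IsNormalizedPair g ξ (WeylScreen.eta ι h Sc ξ) := by
    have := hSc.isNormalizedPair hfr (fun x ↦ (hξ x).1) fun x ↦ (hη x).1
    exact ⟨fun x ↦ hrad ▸ this.mem_radical x, this.apply_eq_one,
      fun x v hv ↦ this.eq_smul x v (hrad ▸ hv)⟩
  obtain ⟨θ, ⟨hθs, hrec⟩, hθu⟩ := hD.weyl.existsUnique g hg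
  have hθ := hhor g hg θ hθs hrec
  obtain ⟨S, hSs, hSsymm, hdec⟩ := WeylScreen.exists_isWeylDecomposition hs hp hD.weyl.symmetric
    hDg hc hηs hθs hθ hrec
  refine ⟨θ, S, ⟨hθs, hθ, hSs, hSsymm, hdec⟩, hrec, fun θ' S' hθ's hθ' _ _ hdec' ↦ ?_,
    fun h1 h2 ↦ hdec.apply_eq_zero_of_mem_radical hp hθ
      (fun x ↦ hξs.diffAt Filter.univ_mem) h1 h2,
    hdec.apply_eq_screenForm hs hp hθ (fun x ↦ (hη x).2) hD.parallel⟩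
  -- A competing pair makes `D` recurrent with form `θ'`, so uniqueness of the Weyl form identifies
  -- `θ'` with `θ`.
  obtain rfl := hθu θ' ⟨hθ's, hdec'.isRecurrent hs hp hc hθ'⟩
  exact ⟨rfl, hdec.unique (fun x ↦ (hξ x).2) hdec'⟩
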